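/- For integers $n$ and $m\ge 1$ call $n$ a primitive root (resp. semi-primitive root) modulo $m$ if $n$ is prime to $m$ and its multiplicative order modulo $m$ is $\varphi(m)$ (resp. $\varphi(m)/2$). Consider the following conditions on a positive integer $m$ (Pei–Feng conditions), where $p_1,p_2,p_3$ are distinct odd primes, $\alpha_0\ge 3$, $\alpha_1,\alpha_2,\alpha_3\ge 1$: (I) $m=4p_1^{\alpha_1}$, and either $2$ is a primitive root mod $p_1^{\alpha_1}$, or $2$ is a semi-primitive root mod $p_1^{\alpha_1}$ and $p_1\equiv 3 \pmod 4$. (II) $m=2^{\alpha_0}p_1^{\alpha_1}$, the order of $p_1$ mod $2^{\alpha_0}$ is $2^{\alpha_0-2}$, $2^{\alpha_0-3}p_1\not\equiv -1 \pmod{2^{\alpha_0}}$, and either $2$ is a primitive root mod $p_1^{\alpha_1}$, or $2$ is a semi-primitive root mod $p_1^{\alpha_1}$ and $p_1\equiv 3\pmod 4$. (III) $m=p_1^{\alpha_1}p_2^{\alpha_2}$, and: if $p_1\equiv p_2\equiv 3 \pmod 4$, then $p_1$ is a primitive root mod $p_2^{\alpha_2}$ and $p_2$ is a semi-primitive root mod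 $p_1^{\alpha_1}$, or vice versa; otherwise, $p_1$ and $p_2$ are primitive roots mod $p_2^{\alpha_2}$ and mod $p_1^{\alpha_1}$ respectively. (IV) $m=4p_1^{\alpha_1}p_2^{\alpha_2}$, $\gcd(p_1-1,p_2-1)=2$, and one of the following holds: (IV,1) $p_1\equiv p_2\equiv 3\pmod 4$; $2$ is a primitive root modulo one of $p_1^{\alpha_1},p_2^{\alpha_2}$ and a semi-primitive root modulo the other; and $p_1$ is a primitive root mod $2p_2^{\alpha_2}$ and $p_2$ is a semi-primitive root mod $2p_1^{\alpha_1}$, or vice versa; (IV,2) $p_1\equiv 1$, $p_2\equiv 3\pmod 4$; $p_1$ and $p_2$ are primitive roots mod $p_2^{\alpha_2}$ and mod $p_1^{\alpha_1}$ respectively; and either $2$ is a primitive root mod $p_2^{\alpha_2}$, or $2$ is a semi-primitive root mod $p_2^{\alpha_2}$ and a primitive root mod $p_1^{\alpha_1}$. (V) $m=p_1^{\alpha_1}p_2^{\alpha_2}p_3^{\alpha_3}$; $p_1\equiv p_2\equiv p_3\equiv 3\pmod 4$; the numbers $(p_i-1)/2$ $(1\le i\le 3)$ are pairwise coprime; $p_1,p_2,p_3$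 are primitive roots mod $p_2^{\alpha_2}$, mod $p_3^{\alpha_3}$, mod $p_1^{\alpha_1}$ respectively, and semi-primitive roots mod $p_3^{\alpha_3}$, mod $p_1^{\alpha_1}$, mod $p_2^{\alpha_2}$ respectively. Let $q$ be a positive integer with at least two distinct prime factors that satisfies none of the conditions (I)–(V). If $q\equiv 2\pmod 4$, assume moreover that $q/2$ is not a prime power and satisfies neither (III) nor (V). For a $q$-periodic function $f:\mathbb Z\to\mathbb C$ let $L(s,f)=\sum_{n\ge1} f(n)n^{-s}$ for $\Re(s)>1$, continued analytically by $L(s,f)=q^{-s}\sum_{a=1}^q f(a)\,\zeta(s,a/q)$, where $\zeta(s,x)$ is the Hurwitz zeta function. Call $f$ of Dirichlet type if $f(n)=0$ whenever $\gcd(n,q)>1$. Then there are infinitely many even, algebraic-valued, $q$-periodic functions $f$ of Dirichlet type that are not constant on the integers prime to $q$ and satisfy $L'(0,f)=0$. -/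

import Mathlib

/-- `n` is a primitive root modulo `m`: its multiplicative order modulo `m` is `φ(m)`.
(For `m ≥ 1` this forces `n` to be prime to `m`, as `orderOf` of a non-unit is `0`.) -/
def IsPrimRootMod (n m : ℕ) : Prop :=
  orderOf (n : ZMod m) = Nat.totient m

/-- `n` is a semi-primitive root modulo `m`: its multiplicative order modulo `m` is `φ(m) / 2`. -/
def IsSemiPrimRootMod (n m : ℕ) : Prop :=
  2 * orderOf (n : ZMod m) = Nat.totient m

/-- `2` is a primitive root modulo `p ^ a`, or it is a semi-primitive root and `p ≡ 3 (mod 4)`. -/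
def TwoGenerates (p a : ℕ) : Prop :=
  IsPrimRootMod 2 (p ^ a) ∨ (IsSemiPrimRootMod 2 (p ^ a) ∧ p % 4 = 3)

/-- `p` is an odd prime. -/
def IsOddPrime (p : ℕ) : Prop := p.Prime ∧ p ≠ 2

/-- Condition (I): `m = 4 p₁ ^ a₁`. -/
def PeiFengI (m : ℕ) : Prop :=
  ∃ p₁ a₁ : ℕ, IsOddPrime p₁ ∧ 1 ≤ a₁ ∧ m = 4 * p₁ ^ a₁ ∧ TwoGenerates p₁ a₁

/-- Condition (II): `m = 2 ^ a₀ p₁ ^ a₁` with `a₀ ≥ 3`. -/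
def PeiFengII (m : ℕ) : Prop :=
  ∃ p₁ a₀ a₁ : ℕ, IsOddPrime p₁ ∧ 3 ≤ a₀ ∧ 1 ≤ a₁ ∧ m = 2 ^ a₀ * p₁ ^ a₁ ∧
    orderOf (p₁ : ZMod (2 ^ a₀)) = 2 ^ (a₀ - 2) ∧
    ¬ ((2 : ℤ) ^ (a₀ - 3) * (p₁ : ℤ) ≡ -1 [ZMOD 2 ^ a₀]) ∧
    TwoGenerates p₁ a₁

/-- Condition (III): `m = p₁ ^ a₁ p₂ ^ a₂`. -/
def PeiFengIII (m : ℕ) : Prop :=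
  ∃ p₁ p₂ a₁ a₂ : ℕ, IsOddPrime p₁ ∧ IsOddPrime p₂ ∧ p₁ ≠ p₂ ∧ 1 ≤ a₁ ∧ 1 ≤ a₂ ∧
    m = p₁ ^ a₁ * p₂ ^ a₂ ∧
    ((p₁ % 4 = 3 ∧ p₂ % 4 = 3 ∧
        ((IsPrimRootMod p₁ (p₂ ^ a₂) ∧ IsSemiPrimRootMod p₂ (p₁ ^ a₁)) ∨
         (IsSemiPrimRootMod p₁ (p₂ ^ a₂) ∧ IsPrimRootMod p₂ (p₁ ^ a₁)))) ∨
     (¬ (p₁ % 4 = 3 ∧ p₂ % 4 = 3) ∧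
        IsPrimRootMod p₁ (p₂ ^ a₂) ∧ IsPrimRootMod p₂ (p₁ ^ a₁)))

/-- Condition (IV): `m = 4 p₁ ^ a₁ p₂ ^ a₂` with `gcd (p₁ - 1, p₂ - 1) = 2`. -/
def PeiFengIV (m : ℕ) : Prop :=
  ∃ p₁ p₂ a₁ a₂ : ℕ, IsOddPrime p₁ ∧ IsOddPrime p₂ ∧ p₁ ≠ p₂ ∧ 1 ≤ a₁ ∧ 1 ≤ a₂ ∧
    m = 4 * p₁ ^ a₁ * p₂ ^ a₂ ∧ Nat.gcd (p₁ - 1) (p₂ - 1) = 2 ∧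
    ((p₁ % 4 = 3 ∧ p₂ % 4 = 3 ∧
        ((IsPrimRootMod 2 (p₁ ^ a₁) ∧ IsSemiPrimRootMod 2 (p₂ ^ a₂)) ∨
         (IsSemiPrimRootMod 2 (p₁ ^ a₁) ∧ IsPrimRootMod 2 (p₂ ^ a₂))) ∧
        ((IsPrimRootMod p₁ (2 * p₂ ^ a₂) ∧ IsSemiPrimRootMod p₂ (2 * p₁ ^ a₁)) ∨
         (IsSemiPrimRootMod p₁ (2 * p₂ ^ a₂) ∧ IsPrimRootMod p₂ (2 * p₁ ^ a₁)))) ∨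
     (p₁ % 4 = 1 ∧ p₂ % 4 = 3 ∧
        (IsPrimRootMod 2 (p₂ ^ a₂) ∨
         (IsSemiPrimRootMod 2 (p₂ ^ a₂) ∧ IsPrimRootMod 2 (p₁ ^ a₁))) ∧
        IsPrimRootMod p₁ (p₂ ^ a₂) ∧ IsPrimRootMod p₂ (p₁ ^ a₁)))

/-- Condition (V): `m = p₁ ^ a₁ p₂ ^ a₂ p₃ ^ a₃` with all three primes `≡ 3 (mod 4)` and the
numbers `(pᵢ - 1) / 2` pairwise coprime. -/
def PeiFengV (m : ℕ) : Prop :=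
  ∃ p₁ p₂ p₃ a₁ a₂ a₃ : ℕ, p₁.Prime ∧ p₂.Prime ∧ p₃.Prime ∧
    p₁ ≠ p₂ ∧ p₂ ≠ p₃ ∧ p₁ ≠ p₃ ∧ 1 ≤ a₁ ∧ 1 ≤ a₂ ∧ 1 ≤ a₃ ∧
    m = p₁ ^ a₁ * p₂ ^ a₂ * p₃ ^ a₃ ∧
    p₁ % 4 = 3 ∧ p₂ % 4 = 3 ∧ p₃ % 4 = 3 ∧
    Nat.Coprime ((p₁ - 1) / 2) ((p₂ - 1) / 2) ∧
    Nat.Coprime ((p₂ - 1) / 2) ((p₃ - 1) / 2) ∧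
    Nat.Coprime ((p₁ - 1) / 2) ((p₃ - 1) / 2) ∧
    IsPrimRootMod p₁ (p₂ ^ a₂) ∧ IsPrimRootMod p₂ (p₃ ^ a₃) ∧ IsPrimRootMod p₃ (p₁ ^ a₁) ∧
    IsSemiPrimRootMod p₁ (p₃ ^ a₃) ∧ IsSemiPrimRootMod p₂ (p₁ ^ a₁) ∧
    IsSemiPrimRootMod p₃ (p₂ ^ a₂)

/-- `m` satisfies at least one of the Pei–Feng conditions (I)–(V). -/
def PeiFeng (m : ℕ) : Prop :=
  PeiFengI m ∨ PeiFengII m ∨ PeiFengIII m ∨ PeiFengIV m ∨ PeiFengV m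

/-- A `q`-periodic arithmetic function, viewed as a function on `ZMod q`, is of Dirichlet type
if it vanishes at all `n` that are not prime to `q`. -/
def IsDirichletType {q : ℕ} (f : ZMod q → ℂ) : Prop :=
  ∀ a : ZMod q, ¬ IsUnit a → f a = 0

/-- A Dirichlet-type function counts as constant if it takes the same value at all residues
prime to `q`; this is the negation. -/
def IsNonconstantOnUnits {q : ℕ} (f : ZMod q → ℂ) : Prop :=
  ∃ a b : ZMod q, IsUnit a ∧ IsUnit b ∧ f a ≠ f b

/-!
Let `χ` be a nontrivial even Dirichlet character modulo a divisor `m` of `q`, and let `ψ` be the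
character modulo `q` that it induces. Then
`L(s, ψ) = L(s, χ) * ∏ r ∣ q, (1 - χ r * r ^ (-s))`, and `L(0, χ) = 0` because `χ` is even. If
`χ p = 1` for some prime `p ∣ q`, then the product vanishes at `0` too, so `L(s, ψ)` has a zero of
order at least two there, and every function `c * ψ` with `c` a positive integer has all the
required properties (`infinite_of_not_generatesUpToSign`).

Write `q = p ^ k * m` with `p` prime to `m` and `k ≥ 1`. A nontrivial character modulo `m` that is
trivial on `-1` and on `p` exists as soon as `-1` and `p` do not generate `(ZMod m)ˣ`
(`exists_even_character_of_not_generatesUpToSign`). It remains to show that if `-1` and `p`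
generate this group for every prime `p ∣ q`, then `q` satisfies a Pei–Feng condition, or is twice an
odd number that is a prime power or satisfies one. This is finite group theory:

* `(ZMod m)ˣ` has at most twice as many elements as the order of `p`, hence at most twice its
  exponent, which is the Carmichael function of `m`. This bounds the number of prime factors of
  `q`, and forces `gcd (p - 1) (r - 1) = 2` when `m` has two odd prime factors `p` and `r`
  (`false_of_three_factors`, `false_of_two_pow_mul`, `gcd_sub_one_eq_two`).
* If `m` is a power of an odd prime `r`, then `p` is a primitive or semi-primitive root modulo `m`,
  according to whether `p` is a nonresidue or a residue modulo `r`; the latter is possible only if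
  `r % 4 = 3` (`primRoot_or_semiPrimRoot`).
* If `m` has two prime factors that are `3` modulo `4`, then `-1` is a nonresidue modulo both, so
  the Legendre symbols of the second generator have to be opposite (`legendreSym_eq_neg`).

Quadratic reciprocity then decides which of the Legendre symbols between the prime factors of `q`
are `1` and which are `-1`, and the result is the list of Pei–Feng conditions.
-/

/-! ### Groups of units generated by `-1` and one more element -/

/-- Every unit modulo `m` is of the form `± g ^ k`. For `g` prime to `m` this says that `-1` and `g`
generate `(ZMod m)ˣ`. Natural exponents suffice, the group being finite. -/
def GeneratesUpToSign (m g : ℕ) : Prop :=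
  ∀ u : (ZMod m)ˣ, ∃ k : ℕ, (u : ZMod m) = (g : ZMod m) ^ k ∨ (u : ZMod m) = -(g : ZMod m) ^ k

namespace GeneratesUpToSign

theorem of_dvd {m d g : ℕ} [NeZero m] (hd : d ∣ m) (h : GeneratesUpToSign m g) :
    GeneratesUpToSign d g := by
  intro u
  obtain ⟨v, rfl⟩ := ZMod.unitsMap_surjective hd u
  obtain ⟨k, hk⟩ := h v
  refine ⟨k, hk.imp (fun hk => ?_) (fun hk => ?_)⟩ <;>
    rw [ZMod.unitsMap_val, ← ZMod.castHom_apply (h := hd), hk] <;>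
    simp only [map_neg, map_pow, map_natCast]

/-- The powers of `g` and their negatives have to cover all units. -/
theorem totient_le {m g : ℕ} [NeZero m] (h : GeneratesUpToSign m g) (hg : g.Coprime m) :
    m.totient ≤ 2 * orderOf (g : ZMod m) := by
  classical
  have hfin : 0 < orderOf (g : ZMod m) := by
    rw [← ZMod.coe_unitOfCoprime g hg, orderOf_units]
    exact orderOf_pos _
  let S : Finset (ZMod m) := (Finset.range (orderOf (g : ZMod m))).image fun k => (g : ZMod m) ^ k
  let T : Finset (ZMod m) := S ∪ S.image fun x => -x
  have hS : S.card ≤ orderOf (g : ZMod m) := Finset.card_image_le.trans (by simp)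
  have hT : T.card ≤ 2 * orderOf (g : ZMod m) := by
    have h1 : (S.image fun x => -x).card ≤ S.card := Finset.card_image_le
    have h2 : T.card ≤ S.card + (S.image fun x => -x).card := Finset.card_union_le _ _
    omega
  have hmem (k : ℕ) : (g : ZMod m) ^ k ∈ S :=
    Finset.mem_image.2 ⟨k % orderOf (g : ZMod m), Finset.mem_range.2 (Nat.mod_lt _ hfin),
      pow_mod_orderOf _ _⟩
  have hsub : (Finset.univ : Finset (ZMod m)ˣ).image Units.val ⊆ T := by
    intro x hx
    obtain ⟨u, -, rfl⟩ := Finset.mem_image.1 hx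
    obtain ⟨k, hk | hk⟩ := h u
    · exact Finset.mem_union_left _ (hk ▸ hmem k)
    · exact Finset.mem_union_right _ (Finset.mem_image.2 ⟨_, hmem k, hk.symm⟩)
  rw [← ZMod.card_units_eq_totient, ← Finset.card_univ,
    ← Finset.card_image_of_injective _ (Units.val_injective (α := ZMod m))]
  exact (Finset.card_le_card hsub).trans hT

end GeneratesUpToSign

open ArithmeticFunction in
theorem orderOf_natCast_dvd_carmichael {m g : ℕ} (hg : g.Coprime m) :
    orderOf (g : ZMod m) ∣ carmichael m := by
  rw [← ZMod.coe_unitOfCoprime g hg, orderOf_units]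
  exact orderOf_dvd_of_pow_eq_one (pow_carmichael _)

namespace GeneratesUpToSign

open ArithmeticFunction

theorem totient_le_carmichael {m g : ℕ} [NeZero m] (h : GeneratesUpToSign m g)
    (hg : g.Coprime m) : m.totient ≤ 2 * carmichael m := by
  have h2 : carmichael m ∣ m.totient := carmichael_dvd_totient m
  have h3 : 0 < m.totient := Nat.totient_pos.2 (NeZero.pos m)
  have h1 := Nat.le_of_dvd (Nat.pos_of_dvd_of_pos h2 h3) (orderOf_natCast_dvd_carmichael hg)
  have := h.totient_le hg
  omega

/-- The totients of the three factors are even, so that the exponent of `(ZMod (a * b * c))ˣ`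
divides a quarter of its order, whereas generation by `-1` and `g` allows only a half. -/
theorem false_of_three_factors {a b c g : ℕ} (ha : 2 < a) (hb : 2 < b) (hc : 2 < c)
    (hab : a.Coprime b) (hac : a.Coprime c) (hbc : b.Coprime c) (hg : g.Coprime (a * b * c))
    (h : GeneratesUpToSign (a * b * c) g) : False := by
  have : NeZero (a * b * c) := ⟨by positivity⟩
  have key := h.totient_le_carmichael hg
  have habc : (a * b).Coprime c := Nat.Coprime.mul_left hac hbc
  rw [carmichael_mul habc, carmichael_mul hab, Nat.totient_mul habc, Nat.totient_mul hab] at key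
  have hla := carmichael_dvd_totient a
  have hlb := carmichael_dvd_totient b
  have hlc := carmichael_dvd_totient c
  obtain ⟨x, hx⟩ := (Nat.totient_even ha).two_dvd
  obtain ⟨y, hy⟩ := (Nat.totient_even hb).two_dvd
  obtain ⟨z, hz⟩ := (Nat.totient_even hc).two_dvd
  have hxp : 0 < x := by have := Nat.totient_pos.2 (show 0 < a by omega); omega
  have hyp : 0 < y := by have := Nat.totient_pos.2 (show 0 < b by omega); omega
  have hzp : 0 < z := by have := Nat.totient_pos.2 (show 0 < c by omega); omega
  rw [hx] at hla key
  rw [hy] at hlb key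
  rw [hz] at hlc key
  have hd : Nat.lcm (Nat.lcm (carmichael a) (carmichael b)) (carmichael c) ∣ 2 * (x * y * z) :=
    Nat.lcm_dvd (Nat.lcm_dvd (hla.trans ⟨y * z, by ring⟩) (hlb.trans ⟨x * z, by ring⟩))
      (hlc.trans ⟨x * y, by ring⟩)
  have hp : 0 < x * y * z := by positivity
  have hle := Nat.le_of_dvd (by positivity) hd
  have : 2 * x * (2 * y) * (2 * z) = 8 * (x * y * z) := by ring
  omega

/-- As `(ZMod (2 ^ k))ˣ` is not cyclic for `3 ≤ k`, the exponent of the group of units loses one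
factor `2` there and another one to the second factor. -/
theorem false_of_two_pow_mul {k b g : ℕ} (hk : 3 ≤ k) (hb : 2 < b)
    (hkb : (2 ^ k).Coprime b) (hg : g.Coprime (2 ^ k * b))
    (h : GeneratesUpToSign (2 ^ k * b) g) : False := by
  have : NeZero (2 ^ k * b) := ⟨by positivity⟩
  have key := h.totient_le_carmichael hg
  rw [carmichael_mul hkb, Nat.totient_mul hkb,
    ← two_mul_carmichael_two_pow_of_three_le_eq_totient hk,
    carmichael_two_pow_of_ne_two (by omega)] at key
  have hlb := carmichael_dvd_totient b
  obtain ⟨y, hy⟩ := (Nat.totient_even hb).two_dvd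
  have hyp : 0 < y := by have := Nat.totient_pos.2 (show 0 < b by omega); omega
  rw [hy] at hlb key
  obtain ⟨j, rfl⟩ := Nat.exists_eq_add_of_le hk
  have e : 2 ^ (3 + j - 2) = 2 * 2 ^ j := by
    rw [show 3 + j - 2 = j + 1 by omega, pow_succ]; ring
  rw [e] at key
  have hd : Nat.lcm (2 * 2 ^ j) (carmichael b) ∣ 2 * (2 ^ j * y) :=
    Nat.lcm_dvd ⟨y, by ring⟩ (hlb.trans ⟨2 ^ j, by ring⟩)
  have hp : 0 < 2 ^ j * y := by positivity
  have hle := Nat.le_of_dvd (by positivity) hd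
  have : 2 * (2 * 2 ^ j) * (2 * y) = 8 * (2 ^ j * y) := by ring
  omega

/-- The order and the exponent of `(ZMod (p ^ a * r ^ b))ˣ` are the product and the least common
multiple of two totients, and their ratio, a greatest common divisor, is at most `2`. -/
theorem gcd_sub_one_eq_two {p r a b g : ℕ} (hp : IsOddPrime p) (hr : IsOddPrime r) (hpr : p ≠ r)
    (ha : 1 ≤ a) (hb : 1 ≤ b) (hg : g.Coprime (p ^ a * r ^ b))
    (h : GeneratesUpToSign (p ^ a * r ^ b) g) : Nat.gcd (p - 1) (r - 1) = 2 := by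
  have hp0 := hp.1.pos
  have hr0 := hr.1.pos
  have : NeZero (p ^ a * r ^ b) := ⟨by positivity⟩
  have key := h.totient_le_carmichael hg
  have hco : (p ^ a).Coprime (r ^ b) :=
    Nat.Coprime.pow _ _ ((Nat.coprime_primes hp.1 hr.1).2 hpr)
  rw [carmichael_mul hco, Nat.totient_mul hco, carmichael_pow_of_prime_ne_two _ hp.1 hp.2,
    carmichael_pow_of_prime_ne_two _ hr.1 hr.2, ← Nat.gcd_mul_lcm] at key
  have hpos : 0 < Nat.lcm (p ^ a).totient (r ^ b).totient :=
    Nat.lcm_pos (Nat.totient_pos.2 (by positivity)) (Nat.totient_pos.2 (by positivity))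
  have hle := Nat.le_of_mul_le_mul_right key hpos
  have hdvd : Nat.gcd (p - 1) (r - 1) ∣ Nat.gcd (p ^ a).totient (r ^ b).totient := by
    rw [Nat.totient_prime_pow hp.1 ha, Nat.totient_prime_pow hr.1 hb]
    exact Nat.gcd_dvd_gcd_of_dvd_left _ (Dvd.intro_left _ rfl) |>.trans
      (Nat.gcd_dvd_gcd_of_dvd_right _ (Dvd.intro_left _ rfl))
  have h2 : 2 ∣ Nat.gcd (p - 1) (r - 1) :=
    Nat.dvd_gcd (hp.1.even_sub_one hp.2).two_dvd (hr.1.even_sub_one hr.2).two_dvd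
  have hgp : 0 < Nat.gcd (p ^ a).totient (r ^ b).totient :=
    Nat.gcd_pos_of_pos_left _ (Nat.totient_pos.2 (by positivity))
  have h1 := Nat.le_of_dvd hgp hdvd
  have h3 := Nat.le_of_dvd (Nat.pos_of_dvd_of_pos hdvd hgp) h2
  omega

theorem orderOf_two_pow {k g : ℕ} (hk : 3 ≤ k) (hg : g.Coprime (2 ^ k))
    (h : GeneratesUpToSign (2 ^ k) g) : orderOf (g : ZMod (2 ^ k)) = 2 ^ (k - 2) := by
  have h1 := orderOf_natCast_dvd_carmichael hg
  have h2 := h.totient_le hg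
  rw [← two_mul_carmichael_two_pow_of_three_le_eq_totient hk] at h2
  rw [carmichael_two_pow_of_ne_two (by omega)] at h1 h2
  have := Nat.le_of_dvd (by positivity) h1
  omega

theorem not_modEq_neg_one {k g : ℕ} (hk : 3 ≤ k) (h : GeneratesUpToSign (2 ^ k) g) :
    ¬ ((2 : ℤ) ^ (k - 3) * (g : ℤ) ≡ -1 [ZMOD 2 ^ k]) := by
  intro hmod
  obtain rfl | hk := hk.eq_or_lt
  -- If `k = 3`, then `g = -1`, and `3` is not of the form `± g ^ n` modulo `8`.
  · have hg : (g : ZMod (2 ^ 3)) = -1 := by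
      have := (ZMod.intCast_eq_intCast_iff (g : ℤ) (-1) (2 ^ 3)).2 (by simpa using hmod)
      simpa using this
    have key : ∃ u : (ZMod (2 ^ 3))ˣ, (u : ZMod (2 ^ 3)) = 3 :=
      ⟨ZMod.unitOfCoprime 3 (by norm_num), by simp⟩
    obtain ⟨u, hu⟩ := key
    obtain ⟨n, hn⟩ := h u
    rw [hu, hg] at hn
    rcases neg_one_pow_eq_or (ZMod (2 ^ 3)) n with h1 | h1 <;> rw [h1] at hn <;>
      revert hn <;> decide
  -- If `k > 3`, then the left-hand side is even.
  · have h2 : (2 : ℤ) ∣ 2 ^ k := dvd_pow_self _ (by omega)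
    have h3 : (2 : ℤ) ∣ 2 ^ (k - 3) * (g : ℤ) := Dvd.dvd.mul_right (dvd_pow_self _ (by omega)) _
    have h4 := h2.trans hmod.dvd
    omega

end GeneratesUpToSign

/-! ### Quadratic residues and orders modulo odd prime powers -/

/-- Half the order of `(ZMod (p ^ a))ˣ`, in the form in which Euler's criterion modulo `p` lifts to
`p ^ a`. -/
theorem two_mul_pow_mul_div_two {p a : ℕ} (hp : IsOddPrime p) (ha : 1 ≤ a) :
    2 * (p / 2 * p ^ (a - 1)) = (p ^ a).totient := by
  rw [Nat.totient_prime_pow hp.1 ha]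
  have : p - 1 = 2 * (p / 2) := by have := hp.1.eq_two_or_odd; have := hp.2; omega
  rw [this]; ring

theorem natCast_pow_eq_one_of_legendreSym {p a g : ℕ} [Fact p.Prime] (ha : 1 ≤ a)
    (h : legendreSym p g = 1) : (g : ZMod (p ^ a)) ^ (p / 2 * p ^ (a - 1)) = 1 := by
  have h1 : ((g : ℤ) : ZMod p) ^ (p / 2) = 1 := by rw [← legendreSym.eq_pow, h]; simp
  have h2 : (p : ℤ) ∣ (g : ℤ) ^ (p / 2) - 1 := by
    rw [← ZMod.intCast_zmod_eq_zero_iff_dvd, Int.cast_sub, Int.cast_pow, h1, Int.cast_one, sub_self]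
  have h3 := dvd_sub_pow_of_dvd_sub h2 (a - 1)
  rw [Nat.sub_add_cancel ha, one_pow] at h3
  have h4 := (ZMod.intCast_zmod_eq_zero_iff_dvd (((g : ℤ) ^ (p / 2)) ^ p ^ (a - 1) - 1) (p ^ a)).2
    (by exact_mod_cast h3)
  push_cast at h4
  rw [pow_mul]
  exact sub_eq_zero.1 h4

theorem legendreSym_of_natCast_pow_eq_one {p a g : ℕ} [Fact p.Prime] (ha : 1 ≤ a) (hp : p ≠ 2)
    (h : (g : ZMod (p ^ a)) ^ (p / 2 * p ^ (a - 1)) = 1) : legendreSym p g = 1 := by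
  have h1 := congrArg (ZMod.castHom (dvd_pow_self p (by omega : a ≠ 0)) (ZMod p)) h
  rw [map_pow, map_natCast, map_one, pow_mul, ZMod.pow_card_pow] at h1
  have h2 := legendreSym.eq_pow p (g : ℤ)
  rw [Int.cast_natCast, h1] at h2
  have hg : ((g : ℤ) : ZMod p) ≠ 0 := by
    intro h0
    rw [(legendreSym.eq_zero_iff p g).2 h0] at h2
    simp at h2
  rcases legendreSym.eq_one_or_neg_one p hg with h3 | h3
  · exact h3
  · rw [h3] at h2
    have : Fact (2 < p) := ⟨by have := (Fact.out : p.Prime).two_le; omega⟩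
    exact absurd (by simpa using h2) (ZMod.neg_one_ne_one (n := p))

theorem exists_legendreSym_eq_neg_one {p : ℕ} [Fact p.Prime] (hp : p ≠ 2) :
    ∃ n : ℕ, legendreSym p n = -1 := by
  obtain ⟨x, hx⟩ := quadraticChar_exists_neg_one (F := ZMod p) ((ZMod.ringChar_zmod_n p).substr hp)
  refine ⟨x.val, ?_⟩
  rw [legendreSym, Int.cast_natCast, ZMod.natCast_zmod_val, hx]

theorem coprime_of_legendreSym_ne_zero {p n : ℕ} [Fact p.Prime] (h : legendreSym p n ≠ 0) :
    n.Coprime p := by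
  rw [Nat.coprime_comm, (Fact.out : p.Prime).coprime_iff_not_dvd, ← ZMod.natCast_eq_zero_iff]
  exact fun h0 => h ((legendreSym.eq_zero_iff p n).2 (by simpa using h0))

theorem legendreSym_eq_pow {m p g n k : ℕ} [Fact p.Prime] (hpm : p ∣ m)
    (h : (n : ZMod m) = (g : ZMod m) ^ k) : legendreSym p n = legendreSym p g ^ k := by
  have h1 := congrArg (ZMod.castHom hpm (ZMod p)) h
  rw [map_pow, map_natCast, map_natCast] at h1
  rw [legendreSym, legendreSym, Int.cast_natCast, Int.cast_natCast, h1, map_pow]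

theorem legendreSym_eq_neg_one_mul_pow {m p g n k : ℕ} [Fact p.Prime] (hpm : p ∣ m)
    (h : (n : ZMod m) = -(g : ZMod m) ^ k) :
    legendreSym p n = legendreSym p (-1) * legendreSym p g ^ k := by
  have h1 := congrArg (ZMod.castHom hpm (ZMod p)) h
  rw [map_neg, map_pow, map_natCast, map_natCast, ← neg_one_mul] at h1
  rw [legendreSym, legendreSym, legendreSym, Int.cast_natCast, Int.cast_natCast, h1, map_mul,
    map_pow, Int.cast_neg, Int.cast_one]

namespace GeneratesUpToSign

/-- The order of `g` is the full order of `(ZMod (p ^ a))ˣ` or half of it, and the Legendre symbol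
tells which. -/
theorem primRoot_or_semiPrimRoot {p a g : ℕ} [Fact p.Prime] (hp : IsOddPrime p) (ha : 1 ≤ a)
    (hg : g.Coprime p) (h : GeneratesUpToSign (p ^ a) g) :
    (legendreSym p g = -1 ∧ IsPrimRootMod g (p ^ a)) ∨
    (legendreSym p g = 1 ∧ IsSemiPrimRootMod g (p ^ a) ∧ p % 4 = 3) := by
  have hp0 := hp.1.pos
  have : NeZero (p ^ a) := ⟨by positivity⟩
  have hga : g.Coprime (p ^ a) := hg.pow_right a
  have hg0 : ((g : ℤ) : ZMod p) ≠ 0 := by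
    rw [Int.cast_natCast, Ne, ZMod.natCast_eq_zero_iff, ← hp.1.coprime_iff_not_dvd]
    exact hg.symm
  have hle := h.totient_le hga
  have hdvd : orderOf (g : ZMod (p ^ a)) ∣ (p ^ a).totient :=
    (orderOf_natCast_dvd_carmichael hga).trans (ArithmeticFunction.carmichael_dvd_totient _)
  have hn := two_mul_pow_mul_div_two hp ha
  have hpos : 0 < (p ^ a).totient := Nat.totient_pos.2 (by positivity)
  rcases legendreSym.eq_one_or_neg_one p hg0 with h1 | h1
  · refine Or.inr ⟨h1, ?_, ?_⟩
    · have h2 := orderOf_dvd_of_pow_eq_one (natCast_pow_eq_one_of_legendreSym ha h1)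
      have := Nat.le_of_dvd (by omega) h2
      unfold IsSemiPrimRootMod
      omega
    · -- Otherwise `-1` is a square as well, and no nonresidue can be reached.
      by_contra h3
      have hneg : legendreSym p (-1) = 1 := by
        rw [legendreSym.eq_one_iff p (by simp)]
        simpa using ZMod.exists_sq_eq_neg_one_iff.2 h3
      obtain ⟨n, hn⟩ := exists_legendreSym_eq_neg_one hp.2
      have hnc : n.Coprime (p ^ a) :=
        (coprime_of_legendreSym_ne_zero (by rw [hn]; decide)).pow_right a
      obtain ⟨k, hk⟩ := h (ZMod.unitOfCoprime n hnc)
      rw [ZMod.coe_unitOfCoprime] at hk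
      have hd : p ∣ p ^ a := dvd_pow_self p (by omega)
      rcases hk with hk | hk
      · have := legendreSym_eq_pow hd hk
        simp [hn, h1] at this
      · have := legendreSym_eq_neg_one_mul_pow hd hk
        simp [hn, h1, hneg] at this
  · refine Or.inl ⟨h1, ?_⟩
    obtain ⟨c, hc⟩ := hdvd
    unfold IsPrimRootMod
    have hc2 : c ≤ 2 := by
      by_contra hc3
      have : 3 * orderOf (g : ZMod (p ^ a)) ≤ orderOf (g : ZMod (p ^ a)) * c := by
        rw [mul_comm]; exact Nat.mul_le_mul_left _ (by omega)
      omega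
    interval_cases c
    · omega
    · omega
    · have h2 : orderOf (g : ZMod (p ^ a)) = p / 2 * p ^ (a - 1) := by omega
      have h3 := legendreSym_of_natCast_pow_eq_one ha hp.2 (h2 ▸ pow_orderOf_eq_one _)
      rw [h1] at h3
      omega

/-- If the two symbols agreed, the product of the quadratic characters modulo `p` and `r` would be
trivial on both `-1` and `g`, hence on all units. -/
theorem legendreSym_eq_neg {p r a b g : ℕ} [Fact p.Prime] [Fact r.Prime] (hpr : p ≠ r)
    (hp : p % 4 = 3) (hr : r % 4 = 3) (ha : 1 ≤ a) (hb : 1 ≤ b)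
    (hg : g.Coprime (p ^ a * r ^ b)) (h : GeneratesUpToSign (p ^ a * r ^ b) g) :
    legendreSym p g = -legendreSym r g := by
  have hpp : p.Prime := Fact.out
  have hrp : r.Prime := Fact.out
  have hp2 : p ≠ 2 := by rintro rfl; omega
  have hneg {s : ℕ} [Fact s.Prime] (hs : s % 4 = 3) : legendreSym s (-1) = -1 := by
    rw [legendreSym.eq_neg_one_iff]
    intro h
    exact ZMod.exists_sq_eq_neg_one_iff.1 (by simpa using h) hs
  have hco : p.Coprime r := (Nat.coprime_primes hpp hrp).2 hpr
  have hdp : p ∣ p ^ a * r ^ b := (dvd_pow_self p (by omega)).mul_right _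
  have hdr : r ∣ p ^ a * r ^ b := (dvd_pow_self r (by omega)).mul_left _
  have hunit {s : ℕ} [Fact s.Prime] (hs : s ∣ p ^ a * r ^ b) : ((g : ℤ) : ZMod s) ≠ 0 := by
    rw [Int.cast_natCast, Ne, ZMod.natCast_eq_zero_iff,
      ← (Fact.out : s.Prime).coprime_iff_not_dvd]
    exact (hg.coprime_dvd_right hs).symm
  by_contra hne
  have heq : legendreSym p g = legendreSym r g := by
    rcases legendreSym.eq_one_or_neg_one p (hunit hdp) with h1 | h1 <;>
    rcases legendreSym.eq_one_or_neg_one r (hunit hdr) with h2 | h2 <;>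
    simp_all
  obtain ⟨n, hn⟩ := exists_legendreSym_eq_neg_one hp2
  -- The product character is `-1` at a number that is a nonresidue modulo `p` and `1` modulo `r`.
  obtain ⟨N, hN1, hN2⟩ := Nat.chineseRemainder hco n 1
  have hN1' : legendreSym p N = -1 := by
    rw [← hn, legendreSym, legendreSym, Int.cast_natCast, Int.cast_natCast,
      (ZMod.natCast_eq_natCast_iff N n p).2 hN1]
  have hN2' : legendreSym r N = 1 := by
    rw [← legendreSym.at_one r, legendreSym, legendreSym, Int.cast_natCast,
      (ZMod.natCast_eq_natCast_iff N 1 r).2 hN2]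
    simp
  have hNc : N.Coprime (p ^ a * r ^ b) :=
    Nat.Coprime.mul_right ((coprime_of_legendreSym_ne_zero (by rw [hN1']; decide)).pow_right a)
      ((coprime_of_legendreSym_ne_zero (by rw [hN2']; decide)).pow_right b)
  obtain ⟨k, hk⟩ := h (ZMod.unitOfCoprime N hNc)
  rw [ZMod.coe_unitOfCoprime] at hk
  rcases hk with hk | hk
  · have h1 := legendreSym_eq_pow hdp hk
    have h2 := legendreSym_eq_pow hdr hk
    rw [hN1', heq, ← h2, hN2'] at h1
    omega
  · have h1 := legendreSym_eq_neg_one_mul_pow hdp hk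
    have h2 := legendreSym_eq_neg_one_mul_pow hdr hk
    rw [hneg hp, ← hneg hr, hN1', heq, ← h2, hN2'] at h1
    omega

end GeneratesUpToSign

/-! ### Moduli with few prime factors -/

theorem IsOddPrime.mod_four {p : ℕ} (hp : IsOddPrime p) : p % 4 = 1 ∨ p % 4 = 3 := by
  have := hp.1.eq_two_or_odd
  have := hp.2
  omega

theorem IsOddPrime.coprime_two {p : ℕ} (hp : IsOddPrime p) : Nat.Coprime 2 p :=
  (Nat.coprime_primes Nat.prime_two hp.1).2 hp.2.symm

theorem IsOddPrime.two_lt_pow {p a : ℕ} (hp : IsOddPrime p) (ha : 1 ≤ a) : 2 < p ^ a := by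
  have h1 : p ≤ p ^ a := Nat.le_self_pow (by omega) p
  have h2 := hp.1.two_le
  have := hp.2
  omega

theorem GeneratesUpToSign.twoGenerates {p a : ℕ} (hp : IsOddPrime p) (ha : 1 ≤ a)
    (h : GeneratesUpToSign (p ^ a) 2) : TwoGenerates p a := by
  have : Fact p.Prime := ⟨hp.1⟩
  exact (h.primRoot_or_semiPrimRoot hp ha hp.coprime_two).imp (·.2) (·.2)

theorem orderOf_natCast_two_mul {g n : ℕ} (hg : Odd g) (hn : Odd n) :
    orderOf (g : ZMod (2 * n)) = orderOf (g : ZMod n) := by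
  refine orderOf_eq_orderOf_iff.2 fun k => ?_
  have hco : Nat.Coprime 2 n := Nat.coprime_two_left.2 hn
  have h2 : g ^ k ≡ 1 [MOD 2] := by
    rw [Nat.ModEq, Nat.odd_iff.1 (hg.pow)]
  have e (M : ℕ) : (g : ZMod M) ^ k = 1 ↔ g ^ k ≡ 1 [MOD M] := by
    rw [← ZMod.natCast_eq_natCast_iff]; push_cast; rfl
  rw [e, e, ← Nat.modEq_and_modEq_iff_modEq_mul hco]
  exact ⟨(·.2), fun h => ⟨h2, h⟩⟩

theorem totient_two_mul_of_odd {n : ℕ} (hn : Odd n) : (2 * n).totient = n.totient := by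
  rw [Nat.totient_mul (Nat.coprime_two_left.2 hn), Nat.totient_two, one_mul]

theorem IsOddPrime.odd {p : ℕ} (hp : IsOddPrime p) : Odd p := hp.1.odd_of_ne_two hp.2

theorem IsPrimRootMod.two_mul {p r b : ℕ} (hp : IsOddPrime p) (hr : IsOddPrime r)
    (h : IsPrimRootMod p (r ^ b)) : IsPrimRootMod p (2 * r ^ b) := by
  unfold IsPrimRootMod at *
  rw [orderOf_natCast_two_mul hp.odd hr.odd.pow, totient_two_mul_of_odd hr.odd.pow, h]

theorem IsSemiPrimRootMod.two_mul {p r b : ℕ} (hp : IsOddPrime p) (hr : IsOddPrime r)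
    (h : IsSemiPrimRootMod p (r ^ b)) : IsSemiPrimRootMod p (2 * r ^ b) := by
  unfold IsSemiPrimRootMod at *
  rw [orderOf_natCast_two_mul hp.odd hr.odd.pow, totient_two_mul_of_odd hr.odd.pow, h]

section TwoPrimes

variable {p r a b : ℕ}

/-- By reciprocity `(p / r)` and `(r / p)` are opposite. -/
theorem exactly_one_primRoot (hp : IsOddPrime p) (hr : IsOddPrime r)
    (hpr : p ≠ r) (ha : 1 ≤ a) (hb : 1 ≤ b) (h1 : GeneratesUpToSign (r ^ b) p)
    (h2 : GeneratesUpToSign (p ^ a) r) (hp4 : p % 4 = 3) (hr4 : r % 4 = 3) :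
    (IsPrimRootMod p (r ^ b) ∧ IsSemiPrimRootMod r (p ^ a)) ∨
      (IsSemiPrimRootMod p (r ^ b) ∧ IsPrimRootMod r (p ^ a)) := by
  have : Fact p.Prime := ⟨hp.1⟩
  have : Fact r.Prime := ⟨hr.1⟩
  have hco := (Nat.coprime_primes hp.1 hr.1).2 hpr
  have hrec := legendreSym.quadratic_reciprocity_three_mod_four hp4 hr4
  rcases h1.primRoot_or_semiPrimRoot hr hb hco with ⟨e1, o1⟩ | ⟨e1, o1, -⟩ <;>
  rcases h2.primRoot_or_semiPrimRoot hp ha hco.symm with ⟨e2, o2⟩ | ⟨e2, o2, -⟩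
  · rw [e1, e2] at hrec; omega
  · exact .inl ⟨o1, o2⟩
  · exact .inr ⟨o1, o2⟩
  · rw [e1, e2] at hrec; omega

/-- As `p % 4 = 1`, the prime `r` has to be a nonresidue modulo `p`; by reciprocity `p` is one
modulo `r`. -/
theorem both_primRoot (hp : IsOddPrime p) (hr : IsOddPrime r)
    (hpr : p ≠ r) (ha : 1 ≤ a) (hb : 1 ≤ b) (h1 : GeneratesUpToSign (r ^ b) p)
    (h2 : GeneratesUpToSign (p ^ a) r) (hp4 : p % 4 = 1) :
    IsPrimRootMod p (r ^ b) ∧ IsPrimRootMod r (p ^ a) := by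
  have : Fact p.Prime := ⟨hp.1⟩
  have : Fact r.Prime := ⟨hr.1⟩
  have hco := (Nat.coprime_primes hp.1 hr.1).2 hpr
  have hrec := legendreSym.quadratic_reciprocity_one_mod_four hp4 hr.2
  rcases h1.primRoot_or_semiPrimRoot hr hb hco with ⟨e1, o1⟩ | ⟨e1, o1, -⟩ <;>
  rcases h2.primRoot_or_semiPrimRoot hp ha hco.symm with ⟨e2, o2⟩ | ⟨e2, o2, e3⟩
  · exact ⟨o1, o2⟩
  · omega
  · rw [e1, e2] at hrec; omega
  · omega

theorem peiFengIII_of_generates (hp : IsOddPrime p) (hr : IsOddPrime r)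
    (hpr : p ≠ r) (ha : 1 ≤ a) (hb : 1 ≤ b) (h1 : GeneratesUpToSign (r ^ b) p)
    (h2 : GeneratesUpToSign (p ^ a) r) : PeiFengIII (p ^ a * r ^ b) := by
  refine ⟨p, r, a, b, hp, hr, hpr, ha, hb, rfl, ?_⟩
  by_cases h3 : p % 4 = 3 ∧ r % 4 = 3
  · exact .inl ⟨h3.1, h3.2, exactly_one_primRoot hp hr hpr ha hb h1 h2 h3.1 h3.2⟩
  · refine .inr ⟨h3, ?_⟩
    rcases hp.mod_four with hp4 | hp4
    · exact both_primRoot hp hr hpr ha hb h1 h2 hp4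
    · exact (both_primRoot hr hp hpr.symm hb ha h2 h1 (by have := hr.mod_four; omega)).symm

theorem peiFengIV_of_generates (hp : IsOddPrime p) (hr : IsOddPrime r)
    (hpr : p ≠ r) (ha : 1 ≤ a) (hb : 1 ≤ b) (h1 : GeneratesUpToSign (r ^ b) p)
    (h2 : GeneratesUpToSign (p ^ a) r) (h : GeneratesUpToSign (p ^ a * r ^ b) 2) :
    PeiFengIV (4 * p ^ a * r ^ b) := by
  have : Fact p.Prime := ⟨hp.1⟩
  have : Fact r.Prime := ⟨hr.1⟩
  have hp0 := hp.1.pos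
  have hr0 := hr.1.pos
  have : NeZero (p ^ a * r ^ b) := ⟨by positivity⟩
  have hc2 : Nat.Coprime 2 (p ^ a * r ^ b) :=
    (hp.coprime_two.pow_right a).mul_right (hr.coprime_two.pow_right b)
  have hgcd := h.gcd_sub_one_eq_two hp hr hpr ha hb hc2
  have h2p := h.of_dvd (Dvd.intro _ rfl)
  have h2r := h.of_dvd (Dvd.intro_left _ rfl)
  have d1 := h2p.primRoot_or_semiPrimRoot hp ha hp.coprime_two
  have d2 := h2r.primRoot_or_semiPrimRoot hr hb hr.coprime_two
  rcases hp.mod_four with hp4 | hp4 <;> rcases hr.mod_four with hr4 | hr4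
  · -- Here `4` would divide the greatest common divisor.
    have : 4 ∣ Nat.gcd (p - 1) (r - 1) := Nat.dvd_gcd (by omega) (by omega)
    omega
  · refine ⟨p, r, a, b, hp, hr, hpr, ha, hb, rfl, hgcd, .inr ⟨hp4, hr4, ?_,
      both_primRoot hp hr hpr ha hb h1 h2 hp4⟩⟩
    rcases d2 with d2 | d2
    · exact .inl d2.2
    · exact .inr ⟨d2.2.1, d1.resolve_right (by omega) |>.2⟩
  · refine ⟨r, p, b, a, hr, hp, hpr.symm, hb, ha, by ring, Nat.gcd_comm _ _ ▸ hgcd,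
      .inr ⟨hr4, hp4, ?_, both_primRoot hr hp hpr.symm hb ha h2 h1 hr4⟩⟩
    rcases d1 with d1 | d1
    · exact .inl d1.2
    · exact .inr ⟨d1.2.1, d2.resolve_right (by omega) |>.2⟩
  · refine ⟨p, r, a, b, hp, hr, hpr, ha, hb, rfl, hgcd, .inl ⟨hp4, hr4, ?_, ?_⟩⟩
    · have hneg := h.legendreSym_eq_neg hpr hp4 hr4 ha hb hc2
      rcases d1 with ⟨e1, o1⟩ | ⟨e1, o1, -⟩ <;> rcases d2 with ⟨e2, o2⟩ | ⟨e2, o2, -⟩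
      · rw [e1, e2] at hneg; omega
      · exact .inl ⟨o1, o2⟩
      · exact .inr ⟨o1, o2⟩
      · rw [e1, e2] at hneg; omega
    · exact (exactly_one_primRoot hp hr hpr ha hb h1 h2 hp4 hr4).imp
        (fun h => ⟨h.1.two_mul hp hr, h.2.two_mul hr hp⟩)
        (fun h => ⟨h.1.two_mul hp hr, h.2.two_mul hr hp⟩)

end TwoPrimes

section ThreePrimes

variable {p r s a b c : ℕ}

/-- At most one of the three primes is `≡ 1 (mod 4)`, as two such would have `4` dividing
`gcd (p - 1) (r - 1)`. If `p` were one, `r` and `s` would be nonresidues modulo `p`, so by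
reciprocity `p` would be a nonresidue modulo both `r` and `s`, as is `-1`. -/
theorem mod_four_eq_three_of_generates (hp : IsOddPrime p) (hr : IsOddPrime r) (hs : IsOddPrime s)
    (hpr : p ≠ r) (hps : p ≠ s) (hrs : r ≠ s) (ha : 1 ≤ a) (hb : 1 ≤ b) (hc : 1 ≤ c)
    (h1 : GeneratesUpToSign (r ^ b * s ^ c) p) (h2 : GeneratesUpToSign (p ^ a * s ^ c) r)
    (h3 : GeneratesUpToSign (p ^ a * r ^ b) s) : p % 4 = 3 := by
  have : Fact p.Prime := ⟨hp.1⟩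
  have : Fact r.Prime := ⟨hr.1⟩
  have : Fact s.Prime := ⟨hs.1⟩
  have hp0 := hp.1.pos
  have hr0 := hr.1.pos
  have hs0 := hs.1.pos
  have : NeZero (p ^ a * r ^ b) := ⟨by positivity⟩
  have : NeZero (p ^ a * s ^ c) := ⟨by positivity⟩
  have cpr := (Nat.coprime_primes hp.1 hr.1).2 hpr
  have cps := (Nat.coprime_primes hp.1 hs.1).2 hps
  have crs := (Nat.coprime_primes hr.1 hs.1).2 hrs
  have g2 := h2.gcd_sub_one_eq_two hp hs hps ha hc
    ((cpr.symm.pow_right a).mul_right (crs.pow_right c))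
  have g3 := h3.gcd_sub_one_eq_two hp hr hpr ha hb
    ((cps.symm.pow_right a).mul_right (crs.symm.pow_right b))
  by_contra hp3
  have hp4 : p % 4 = 1 := hp.mod_four.resolve_right hp3
  have hr4 : r % 4 = 3 := hr.mod_four.resolve_left fun hr4 => by
    have : 4 ∣ Nat.gcd (p - 1) (r - 1) := Nat.dvd_gcd (by omega) (by omega)
    omega
  have hs4 : s % 4 = 3 := hs.mod_four.resolve_left fun hs4 => by
    have : 4 ∣ Nat.gcd (p - 1) (s - 1) := Nat.dvd_gcd (by omega) (by omega)
    omega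
  have e2 := ((h2.of_dvd (Dvd.intro _ rfl)).primRoot_or_semiPrimRoot hp ha cpr.symm).resolve_right
    (by omega) |>.1
  have e3 := ((h3.of_dvd (Dvd.intro _ rfl)).primRoot_or_semiPrimRoot hp ha cps.symm).resolve_right
    (by omega) |>.1
  have e1 := h1.legendreSym_eq_neg hrs hr4 hs4 hb hc ((cpr.pow_right b).mul_right (cps.pow_right c))
  rw [legendreSym.quadratic_reciprocity_one_mod_four hp4 hr.2,
    legendreSym.quadratic_reciprocity_one_mod_four hp4 hs.2, e2, e3] at e1
  omega

theorem coprime_half_sub_one (hp : IsOddPrime p) (hr : IsOddPrime r)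
    (h : Nat.gcd (p - 1) (r - 1) = 2) : Nat.Coprime ((p - 1) / 2) ((r - 1) / 2) := by
  rw [Nat.Coprime, Nat.gcd_div (hp.1.even_sub_one hp.2).two_dvd (hr.1.even_sub_one hr.2).two_dvd,
    h, Nat.div_self two_pos]

/-- The value `(p / r) = -1` of the Legendre symbol determines the five other symbols between the
three primes: two symbols with the same upper entry are opposite, and so are `(x / y)` and
`(y / x)`. -/
theorem peiFengV_of_legendreSym (hp : IsOddPrime p) (hr : IsOddPrime r) (hs : IsOddPrime s)
    (hpr : p ≠ r) (hps : p ≠ s) (hrs : r ≠ s) (ha : 1 ≤ a) (hb : 1 ≤ b) (hc : 1 ≤ c)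
    (h1 : GeneratesUpToSign (r ^ b * s ^ c) p) (h2 : GeneratesUpToSign (p ^ a * s ^ c) r)
    (h3 : GeneratesUpToSign (p ^ a * r ^ b) s) (hp4 : p % 4 = 3) (hr4 : r % 4 = 3)
    (hs4 : s % 4 = 3) [Fact r.Prime] (hleg : legendreSym r p = -1) :
    PeiFengV (p ^ a * r ^ b * s ^ c) := by
  have : Fact p.Prime := ⟨hp.1⟩
  have : Fact s.Prime := ⟨hs.1⟩
  have hp0 := hp.1.pos
  have hr0 := hr.1.pos
  have hs0 := hs.1.pos
  have : NeZero (p ^ a * r ^ b) := ⟨by positivity⟩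
  have : NeZero (p ^ a * s ^ c) := ⟨by positivity⟩
  have : NeZero (r ^ b * s ^ c) := ⟨by positivity⟩
  have cpr := (Nat.coprime_primes hp.1 hr.1).2 hpr
  have cps := (Nat.coprime_primes hp.1 hs.1).2 hps
  have crs := (Nat.coprime_primes hr.1 hs.1).2 hrs
  have c1 := (cpr.pow_right b).mul_right (cps.pow_right c)
  have c2 := (cpr.symm.pow_right a).mul_right (crs.pow_right c)
  have c3 := (cps.symm.pow_right a).mul_right (crs.symm.pow_right b)
  have e1 := h1.legendreSym_eq_neg hrs hr4 hs4 hb hc c1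
  have e2 := h2.legendreSym_eq_neg hps hp4 hs4 ha hc c2
  have e3 := h3.legendreSym_eq_neg hpr hp4 hr4 ha hb c3
  have qpr := legendreSym.quadratic_reciprocity_three_mod_four hp4 hr4
  have qps := legendreSym.quadratic_reciprocity_three_mod_four hp4 hs4
  have dpr := (h1.of_dvd (Dvd.intro _ rfl)).primRoot_or_semiPrimRoot hr hb cpr
  have dps := (h1.of_dvd (Dvd.intro_left _ rfl)).primRoot_or_semiPrimRoot hs hc cps
  have drp := (h2.of_dvd (Dvd.intro _ rfl)).primRoot_or_semiPrimRoot hp ha cpr.symm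
  have drs := (h2.of_dvd (Dvd.intro_left _ rfl)).primRoot_or_semiPrimRoot hs hc crs
  have dsp := (h3.of_dvd (Dvd.intro _ rfl)).primRoot_or_semiPrimRoot hp ha cps.symm
  have dsr := (h3.of_dvd (Dvd.intro_left _ rfl)).primRoot_or_semiPrimRoot hr hb crs.symm
  exact ⟨p, r, s, a, b, c, hp.1, hr.1, hs.1, hpr, hrs, hps, ha, hb, hc, rfl, hp4, hr4, hs4,
    coprime_half_sub_one hp hr (h3.gcd_sub_one_eq_two hp hr hpr ha hb c3),
    coprime_half_sub_one hr hs (h1.gcd_sub_one_eq_two hr hs hrs hb hc c1),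
    coprime_half_sub_one hp hs (h2.gcd_sub_one_eq_two hp hs hps ha hc c2),
    (dpr.resolve_right (by omega)).2, (drs.resolve_right (by omega)).2,
    (dsp.resolve_right (by omega)).2, (dps.resolve_left (by omega)).2.1,
    (drp.resolve_left (by omega)).2.1, (dsr.resolve_left (by omega)).2.1⟩

/-- Of the symbols `(p / r)` and `(p / s)` exactly one is `-1`; exchanging `r` and `s` if necessary,
it is the first. -/
theorem peiFengV_of_generates (hp : IsOddPrime p) (hr : IsOddPrime r) (hs : IsOddPrime s)
    (hpr : p ≠ r) (hps : p ≠ s) (hrs : r ≠ s) (ha : 1 ≤ a) (hb : 1 ≤ b) (hc : 1 ≤ c)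
    (h1 : GeneratesUpToSign (r ^ b * s ^ c) p) (h2 : GeneratesUpToSign (p ^ a * s ^ c) r)
    (h3 : GeneratesUpToSign (p ^ a * r ^ b) s) : PeiFengV (p ^ a * r ^ b * s ^ c) := by
  have : Fact r.Prime := ⟨hr.1⟩
  have : Fact s.Prime := ⟨hs.1⟩
  have hr0 := hr.1.pos
  have hs0 := hs.1.pos
  have : NeZero (r ^ b * s ^ c) := ⟨by positivity⟩
  have cpr := (Nat.coprime_primes hp.1 hr.1).2 hpr
  have cps := (Nat.coprime_primes hp.1 hs.1).2 hps
  have h1' := mul_comm (r ^ b) (s ^ c) ▸ h1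
  have h2' := mul_comm (p ^ a) (s ^ c) ▸ h2
  have h3' := mul_comm (p ^ a) (r ^ b) ▸ h3
  have hp4 := mod_four_eq_three_of_generates hp hr hs hpr hps hrs ha hb hc h1 h2 h3
  have hr4 := mod_four_eq_three_of_generates hr hp hs hpr.symm hrs hps hb ha hc h2 h1 h3'
  have hs4 := mod_four_eq_three_of_generates hs hp hr hps.symm hrs.symm hpr hc ha hb h3 h1' h2'
  have e1 := h1.legendreSym_eq_neg hrs hr4 hs4 hb hc
    ((cpr.pow_right b).mul_right (cps.pow_right c))
  rcases (h1.of_dvd (Dvd.intro _ rfl)).primRoot_or_semiPrimRoot hr hb cpr with ⟨h, -⟩ | ⟨h, -⟩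
  · exact peiFengV_of_legendreSym hp hr hs hpr hps hrs ha hb hc h1 h2 h3 hp4 hr4 hs4 h
  · have := peiFengV_of_legendreSym hp hs hr hps hpr hrs.symm ha hc hb h1' h3 h2 hp4 hs4 hr4
      (by omega)
    rwa [mul_right_comm] at this

end ThreePrimes

/-! ### The classification -/

/-- For every prime `p ∣ q`, the units modulo the largest divisor of `q` prime to `p` are generated
by `-1` and `p`. -/
def GeneratesUpToSignAtPrimes (q : ℕ) : Prop :=
  ∀ p k m : ℕ, p.Prime → 1 ≤ k → p.Coprime m → q = p ^ k * m → GeneratesUpToSign m p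

theorem exists_primePow_mul_of_odd {n : ℕ} (hn : Odd n) (h1 : n ≠ 1) :
    ∃ p a m : ℕ, IsOddPrime p ∧ 1 ≤ a ∧ p.Coprime m ∧ Odd m ∧ n = p ^ a * m := by
  have hp := Nat.minFac_prime h1
  obtain ⟨a, m, hm, e⟩ := Nat.exists_eq_pow_mul_and_not_dvd hn.pos.ne' n.minFac hp.ne_one
  refine ⟨n.minFac, a, m, ⟨hp, ?_⟩, ?_, (hp.coprime_iff_not_dvd).2 hm, ?_, e⟩
  · intro h2
    have := h2 ▸ n.minFac_dvd
    have := Nat.odd_iff.1 hn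
    omega
  · by_contra ha
    have ha0 : a = 0 := by omega
    rw [ha0, pow_zero, one_mul] at e
    exact hm (e ▸ n.minFac_dvd)
  · rw [e] at hn
    exact (Nat.odd_mul.1 hn).2

theorem two_lt_of_odd {n : ℕ} (hn : Odd n) (h1 : n ≠ 1) : 2 < n := by
  obtain ⟨k, rfl⟩ := hn
  omega

namespace GeneratesUpToSignAtPrimes

theorem classify_odd {n : ℕ} (hn : Odd n) (h : GeneratesUpToSignAtPrimes n) :
    n = 1 ∨ IsPrimePow n ∨ PeiFengIII n ∨ PeiFengV n := by
  by_cases h1 : n = 1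
  · exact .inl h1
  obtain ⟨p, a, m, hp, ha, cpm, hm, rfl⟩ := exists_primePow_mul_of_odd hn h1
  by_cases hm1 : m = 1
  · rw [hm1, mul_one]
    exact .inr (.inl (hp.1.isPrimePow.pow (by omega)))
  obtain ⟨r, b, l, hr, hb, crl, hl, rfl⟩ := exists_primePow_mul_of_odd hm hm1
  have cpr : p.Coprime r := cpm.coprime_dvd_right ((dvd_pow_self r (by omega)).mul_right l)
  have cpl : p.Coprime l := cpm.coprime_dvd_right (Dvd.intro_left _ rfl)
  have hpr : p ≠ r := (Nat.coprime_primes hp.1 hr.1).1 cpr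
  have hP := h p a _ hp.1 ha cpm rfl
  have hR := h r b (p ^ a * l) hr.1 hb ((cpr.symm.pow_right a).mul_right crl) (by ring)
  by_cases hl1 : l = 1
  · rw [hl1, mul_one] at hP hR ⊢
    exact .inr (.inr (.inl (peiFengIII_of_generates hp hr hpr ha hb hP hR)))
  obtain ⟨s, c, t, hs, hc, cst, ht, rfl⟩ := exists_primePow_mul_of_odd hl hl1
  have hsd : s ∣ s ^ c * t := (dvd_pow_self s (by omega)).mul_right t
  have htd : t ∣ s ^ c * t := Dvd.intro_left _ rfl
  have cps : p.Coprime s := cpl.coprime_dvd_right hsd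
  have crs : r.Coprime s := crl.coprime_dvd_right hsd
  have cpt : p.Coprime t := cpl.coprime_dvd_right htd
  have crt : r.Coprime t := crl.coprime_dvd_right htd
  by_cases ht1 : t = 1
  · have hS := h s c (p ^ a * r ^ b) hs.1 hc ((cps.symm.pow_right a).mul_right
      (crs.symm.pow_right b)) (by rw [ht1]; ring)
    rw [ht1, mul_one] at hP hR ⊢
    have := peiFengV_of_generates hp hr hs hpr ((Nat.coprime_primes hp.1 hs.1).1 cps)
      ((Nat.coprime_primes hr.1 hs.1).1 crs) ha hb hc hP hR hS
    rw [← mul_assoc]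
    exact .inr (.inr (.inr this))
  · exfalso
    rw [← mul_assoc] at hP
    exact hP.false_of_three_factors (hr.two_lt_pow hb) (hs.two_lt_pow hc) (two_lt_of_odd ht ht1)
      (crs.pow _ _) (crt.pow_left _) (cst.pow_left _)
      (((cpr.pow_right b).mul_right (cps.pow_right c)).mul_right cpt)

theorem peiFeng_of_two_pow_mul {k n : ℕ} (hk : 2 ≤ k) (hn : Odd n) (h1 : n ≠ 1)
    (h : GeneratesUpToSignAtPrimes (2 ^ k * n)) : PeiFeng (2 ^ k * n) := by
  have h2 := h 2 k n Nat.prime_two (by omega) (Nat.coprime_two_left.2 hn) rfl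
  obtain ⟨p, a, m, hp, ha, cpm, hm, rfl⟩ := exists_primePow_mul_of_odd hn h1
  have hP := h p a (2 ^ k * m) hp.1 ha ((hp.coprime_two.symm.pow_right k).mul_right cpm) (by ring)
  by_cases hm1 : m = 1
  · rw [hm1, mul_one] at hP h2 ⊢
    have htwo := h2.twoGenerates hp ha
    obtain rfl | hk := hk.eq_or_lt
    · exact .inl ⟨p, a, hp, ha, by norm_num, htwo⟩
    · exact .inr (.inl ⟨p, k, a, hp, hk, ha, rfl,
        hP.orderOf_two_pow hk (hp.coprime_two.symm.pow_right k), hP.not_modEq_neg_one hk, htwo⟩)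
  obtain rfl | hk := hk.eq_or_lt
  · obtain ⟨r, b, l, hr, hb, crl, hl, rfl⟩ := exists_primePow_mul_of_odd hm hm1
    have cpr : p.Coprime r := cpm.coprime_dvd_right ((dvd_pow_self r (by omega)).mul_right l)
    have cpl : p.Coprime l := cpm.coprime_dvd_right (Dvd.intro_left _ rfl)
    have hpr : p ≠ r := (Nat.coprime_primes hp.1 hr.1).1 cpr
    rw [← mul_assoc] at h2
    by_cases hl1 : l = 1
    · have hR := h r b (2 ^ 2 * p ^ a) hr.1 hb ((hr.coprime_two.symm.pow_right 2).mul_right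
        (cpr.symm.pow_right a)) (by rw [hl1]; ring)
      rw [hl1, mul_one] at hP h2 ⊢
      have hp0 := hp.1.pos
      have hr0 := hr.1.pos
      have : NeZero (2 ^ 2 * p ^ a) := ⟨by positivity⟩
      have : NeZero (2 ^ 2 * r ^ b) := ⟨by positivity⟩
      have := peiFengIV_of_generates hp hr hpr ha hb (hP.of_dvd (Dvd.intro_left _ rfl))
        (hR.of_dvd (Dvd.intro_left _ rfl)) h2
      rw [mul_assoc] at this
      exact .inr (.inr (.inr (.inl this)))
    · exact (h2.false_of_three_factors (hp.two_lt_pow ha) (hr.two_lt_pow hb)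
        (two_lt_of_odd hl hl1) (cpr.pow _ _) (cpl.pow_left _) (crl.pow_left _)
        (((hp.coprime_two.pow_right a).mul_right (hr.coprime_two.pow_right b)).mul_right
          (Nat.coprime_two_left.2 hl))).elim
  · exact (hP.false_of_two_pow_mul hk (two_lt_of_odd hm hm1)
      ((Nat.coprime_two_left.2 hm).pow_left k)
      ((hp.coprime_two.symm.pow_right k).mul_right cpm)).elim

theorem of_two_mul {n : ℕ} (hn : Odd n) (h : GeneratesUpToSignAtPrimes (2 * n)) :
    GeneratesUpToSignAtPrimes n := by
  rintro p k m hp hk hpm rfl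
  have hodd := Nat.odd_mul.1 hn
  have : NeZero (2 * m) := ⟨by have := hodd.2.pos; omega⟩
  have hp2 : p.Coprime 2 := by
    have := (Nat.coprime_two_left.2 hodd.1).symm
    exact this.coprime_dvd_left (dvd_pow_self p (by omega))
  exact (h p k (2 * m) hp hk (hp2.mul_right hpm) (by ring)).of_dvd (Dvd.intro_left _ rfl)

end GeneratesUpToSignAtPrimes

/-! ### Characters and `L`-functions -/

/-- Duality for finite abelian groups, with the instance arguments settled for `ℂ`. -/
theorem exists_monoidHom_complex_apply_ne_one {Q : Type*} [CommGroup Q] [Finite Q] {a : Q}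
    (ha : a ≠ 1) : ∃ φ : Q →* ℂˣ, φ a ≠ 1 := by
  have : NeZero (Monoid.exponent Q) := ⟨Monoid.exponent_ne_zero_of_finite⟩
  exact CommGroup.exists_apply_ne_one_of_hasEnoughRootsOfUnity Q ℂ ha

open DirichletCharacter in
/-- If the classes `± g ^ k` do not exhaust the units modulo `m`, then the quotient by the subgroup
they form carries a nontrivial character. -/
theorem exists_even_character_of_not_generatesUpToSign {m g : ℕ} [NeZero m] (hg : g.Coprime m)
    (h : ¬ GeneratesUpToSign m g) :
    ∃ χ : DirichletCharacter ℂ m, χ ≠ 1 ∧ χ.Even ∧ χ g = 1 := by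
  obtain ⟨u, hu⟩ := not_forall.1 h
  let v : (ZMod m)ˣ := ZMod.unitOfCoprime g hg
  let H : Subgroup (ZMod m)ˣ := Subgroup.closure {-1, v}
  have huH : u ∉ H := by
    intro hmem
    obtain ⟨i, j, hij⟩ := Subgroup.mem_closure_pair.1 hmem
    obtain ⟨k, hk : v ^ k = v ^ j⟩ := (mem_powers_iff_mem_zpowers (x := v)).2 ⟨j, rfl⟩
    refine hu ⟨k, ?_⟩
    rw [← hij, ← hk, ← ZMod.coe_unitOfCoprime g hg]
    rcases Int.even_or_odd i with hi | hi
    · left; simp [hi.neg_one_zpow, v]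
    · right; simp [hi.neg_one_zpow, v]
  have hne : (QuotientGroup.mk u : (ZMod m)ˣ ⧸ H) ≠ 1 :=
    fun h => huH ((QuotientGroup.eq_one_iff u).1 h)
  obtain ⟨φ, hφ⟩ := exists_monoidHom_complex_apply_ne_one hne
  let χ : DirichletCharacter ℂ m := MulChar.ofUnitHom (φ.comp (QuotientGroup.mk' H))
  have hval (w : (ZMod m)ˣ) : χ w = (φ (QuotientGroup.mk w) : ℂˣ) := by
    simp [χ]
  have hH {w : (ZMod m)ˣ} (hw : w ∈ H) : χ w = 1 := by
    rw [hval, (QuotientGroup.eq_one_iff w).2 hw, map_one, Units.val_one]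
  refine ⟨χ, fun h1 => hφ ?_, ?_, ?_⟩
  · have := hval u
    rw [h1, MulChar.one_apply_coe] at this
    exact Units.val_eq_one.1 this.symm
  · have := hH (w := -1) (Subgroup.subset_closure (by simp))
    simpa [DirichletCharacter.Even] using this
  · have := hH (w := v) (Subgroup.subset_closure (by simp))
    simpa [v] using this

open DirichletCharacter in
/-- Both `L(s, χ)` and the Euler factor at `p` vanish at `0`. -/
theorem hasDerivAt_LFunction_changeLevel_zero {m q p : ℕ} [NeZero m] [NeZero q] (hmq : m ∣ q)
    (hp : p ∈ q.primeFactors) {χ : DirichletCharacter ℂ m} (hχ : χ ≠ 1) (heven : χ.Even)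
    (hχp : χ p = 1) : HasDerivAt (LFunction (changeLevel hmq χ)) 0 0 := by
  have hL : LFunction χ 0 = 0 := by
    -- Modulo `1` there is no nontrivial character, so that `χ 0 = 0`.
    have hm : (0 : ZMod m) ≠ 1 := by
      intro h01
      have := subsingleton_of_zero_eq_one h01
      exact hχ (MulChar.ext fun a => by simp [Subsingleton.elim a 1])
    have : Nontrivial (ZMod m) := ⟨⟨_, _, hm⟩⟩
    rw [LFunction, ZMod.LFunction_apply_zero_of_even heven.to_fun, MulChar.map_zero]
    simp
  have hfun : LFunction (changeLevel hmq χ) =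
      LFunction χ * fun s : ℂ => ∏ r ∈ q.primeFactors, (1 - χ r * (r : ℂ) ^ (-s)) :=
    funext fun s => LFunction_changeLevel hmq χ (.inl hχ)
  have hprod : DifferentiableAt ℂ
      (fun s : ℂ => ∏ r ∈ q.primeFactors, (1 - χ r * (r : ℂ) ^ (-s))) 0 := by
    refine DifferentiableAt.fun_finsetProd fun r hr => ?_
    have hr0 : (r : ℂ) ≠ 0 := Nat.cast_ne_zero.2 (Nat.prime_of_mem_primeFactors hr).ne_zero
    exact (differentiableAt_const _).sub
      ((differentiableAt_id.neg.const_cpow (.inl hr0)).const_mul _)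
  have hzero : ∏ r ∈ q.primeFactors, (1 - χ r * (r : ℂ) ^ (-(0 : ℂ))) = 0 :=
    Finset.prod_eq_zero hp (by simp [hχp])
  have := ((differentiable_LFunction hχ) 0).hasDerivAt.mul hprod.hasDerivAt
  rw [hL, hzero, mul_zero, zero_mul, add_zero] at this
  rwa [hfun]

theorem infinite_of_not_generatesUpToSign {q p k m : ℕ} [NeZero q] (hp : p.Prime) (hk : 1 ≤ k)
    (hpm : p.Coprime m) (hq : q = p ^ k * m) (h : ¬ GeneratesUpToSign m p) :
    {f : ZMod q → ℂ | (∀ a, IsAlgebraic ℚ (f a)) ∧ Function.Even f ∧ IsDirichletType f ∧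
      IsNonconstantOnUnits f ∧ HasDerivAt (ZMod.LFunction f) 0 0}.Infinite := by
  have hq0 : q ≠ 0 := NeZero.ne q
  have hmq : m ∣ q := ⟨p ^ k, by rw [hq, mul_comm]⟩
  have : NeZero m := ⟨fun h => hq0 (by rw [hq, h, mul_zero])⟩
  have hpq : p ∈ q.primeFactors :=
    Nat.mem_primeFactors.2 ⟨hp, hq ▸ (dvd_pow_self p (by omega)).mul_right m, hq0⟩
  obtain ⟨χ, hχ, heven, hχp⟩ := exists_even_character_of_not_generatesUpToSign hpm h
  let ψ : DirichletCharacter ℂ q := DirichletCharacter.changeLevel hmq χ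
  have hψ1 : ψ ≠ 1 := fun h => hχ ((DirichletCharacter.changeLevel_eq_one_iff hmq).1 h)
  have hderiv : HasDerivAt (ZMod.LFunction ψ) 0 0 :=
    hasDerivAt_LFunction_changeLevel_zero hmq hpq hχ heven hχp
  have hψeven : ψ.Even := by
    have := DirichletCharacter.changeLevel_eq_cast_of_dvd χ hmq (-1)
    have h2 : (((-1 : (ZMod q)ˣ) : ZMod q).cast : ZMod m) = -1 := by
      rw [← ZMod.castHom_apply (h := hmq), Units.val_neg, Units.val_one, map_neg, map_one]
    rw [h2, heven] at this
    simpa [DirichletCharacter.Even] using this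
  obtain ⟨u, hu⟩ := MulChar.ne_one_iff.1 hψ1
  have hinj : Function.Injective fun n : ℕ => fun a : ZMod q => ((n + 1 : ℕ) : ℂ) * ψ a := by
    intro n n' hn
    have := congrFun hn 1
    simp only [map_one, mul_one, Nat.cast_inj] at this
    omega
  refine Set.infinite_of_injective_forall_mem hinj fun n => ⟨fun a => ?_, fun a => ?_,
    fun a ha => ?_, ⟨u, 1, u.isUnit, isUnit_one, fun h1 => hu ?_⟩, ?_⟩
  · refine (isAlgebraic_natCast (n + 1)).mul ?_
    by_cases ha : IsUnit a
    · obtain ⟨v, rfl⟩ := ha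
      refine IsAlgebraic.of_pow (Fintype.card_pos (α := (ZMod q)ˣ)) ?_
      rw [← map_pow, ← Units.val_pow_eq_pow_val, pow_card_eq_one, Units.val_one, map_one]
      exact isAlgebraic_one
    · rw [MulChar.map_nonunit ψ ha]
      exact isAlgebraic_zero
  · simp only [hψeven.to_fun a]
  · simp only [MulChar.map_nonunit ψ ha, mul_zero]
  · simpa using mul_left_cancel₀ (Nat.cast_ne_zero.2 (Nat.succ_ne_zero n)) h1
  · have hmul : ZMod.LFunction (fun a : ZMod q => ((n + 1 : ℕ) : ℂ) * ψ a) =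
        fun s => ((n + 1 : ℕ) : ℂ) * ZMod.LFunction ψ s := by
      funext s
      simp only [ZMod.LFunction, Finset.mul_sum]
      exact Finset.sum_congr rfl fun a _ => by ring
    rw [hmul]
    simpa using hderiv.const_mul ((n + 1 : ℕ) : ℂ)

theorem mainTheorem8 (q : ℕ) [NeZero q]
    (hq : 2 ≤ q.primeFactors.card)
    (hPF : ¬ PeiFeng q)
    (hq2 : q % 4 = 2 → ¬ IsPrimePow (q / 2) ∧ ¬ PeiFengIII (q / 2) ∧ ¬ PeiFengV (q / 2)) :
    {f : ZMod q → ℂ | (∀ a, IsAlgebraic ℚ (f a)) ∧ Function.Even f ∧ IsDirichletType f ∧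
      IsNonconstantOnUnits f ∧ HasDerivAt (ZMod.LFunction f) 0 0}.Infinite := by
  suffices hgen : ¬ GeneratesUpToSignAtPrimes q by
    simp only [GeneratesUpToSignAtPrimes, not_forall] at hgen
    obtain ⟨p, k, m, hp, hk, hpm, e, h⟩ := hgen
    exact infinite_of_not_generatesUpToSign hp hk hpm e h
  intro h
  obtain ⟨k, n, hn, rfl⟩ := Nat.exists_eq_two_pow_mul_odd (NeZero.ne q)
  have hn1 : n ≠ 1 := by
    rintro rfl
    rw [mul_one] at hq
    obtain rfl | hk := Nat.eq_zero_or_pos k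
    · simp at hq
    · rw [Nat.primeFactors_prime_pow hk.ne' Nat.prime_two, Finset.card_singleton] at hq
      omega
  obtain rfl | rfl | hk : k = 0 ∨ k = 1 ∨ 2 ≤ k := by omega
  · rw [pow_zero, one_mul] at h hPF hq
    rcases h.classify_odd hn with h | h | h | h
    · exact hn1 h
    · have := isPrimePow_iff_card_primeFactors_eq_one.1 h
      omega
    · exact hPF (.inr (.inr (.inl h)))
    · exact hPF (.inr (.inr (.inr (.inr h))))
  -- For `q = 2 * n` with `n` odd, the generation hypothesis passes from `q` to `n`.
  · rw [pow_one] at h hq2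
    rw [Nat.mul_div_cancel_left n two_pos] at hq2
    obtain ⟨h1, h2, h3⟩ := hq2 (by have := Nat.odd_iff.1 hn; omega)
    rcases (h.of_two_mul hn).classify_odd hn with h | h | h | h <;> contradiction
  · exact hPF (h.peiFeng_of_two_pow_mul hk hn hn1)
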